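/- For $n,k\in\mathbb{Z}$ with $n\ge 1$, let $I_{n,k}$ be the number of involutions of $\{1,\dots,n\}$ (permutations $\pi$ with $\pi\circ\pi=\mathrm{id}$, the identity included) that have exactly $k$ descents, a descent of $\pi$ being an index $1\le i\le n-1$ with $\pi(i)>\pi(i+1)$; thus $I_{n,k}=0$ for $k<0$. Let $I_n(t)=\sum_{k=0}^{n-1} I_{n,k}t^k$. Then for all $n\ge 3$ and $k\ge 0$, $$ \begin{aligned} n I_{n,k} ={}& (k+1)\, I_{n-1,k} + (n-k)\, I_{n-1,k-1} + [(k+1)^2+n-2]\, I_{n-2,k} \\ & + [2k(n-k-1)-n+3]\, I_{n-2,k-1} + [(n-k)^2+n-2]\, I_{n-2,k-2}. \end{aligned} $$ Equivalently, in terms of the polynomials $I_n(t)$, for all $n\ge 3$, $$ \begin{aligned} nI_{n}(t) ={}& (t-t^2)\,I_{n-1}'(t)+[1+(n-1)t]\,I_{n-1}(t)+t^2(1-t)^2\,I_{n-2}''(t)\\ & +t(1-t)[3+(2n-5)t]\,I_{n-2}'(t)+(n-1)[1+t+(n-2)t^2]\,I_{n-2}(t). \end{aligned} $$ -/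

import Mathlib

/-- The involutions of an `n`-element linearly ordered set (here `Fin n`, playing the role of
`{1, …, n}`): the permutations `π` with `π (π i) = i` for all `i`; the identity is included. -/
def involutions (n : ℕ) : Finset (Equiv.Perm (Fin n)) :=
  Finset.univ.filter fun π => ∀ i, π (π i) = i

/-- The descent number of `π`: the number of positions `i` that are not the last one and
satisfy `π i > π (i + 1)`. -/
def descentNumber {n : ℕ} (π : Equiv.Perm (Fin n)) : ℕ :=
  (Finset.univ.filter fun i : Fin n => ∃ h : (i : ℕ) + 1 < n, π ⟨(i : ℕ) + 1, h⟩ < π i).card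

/-- The number of involutions of `{1, …, n}` with exactly `k` descents. The index `k` is an
integer, so the number is `0` for `k < 0`. -/
def involutionDescentCount (n : ℕ) (k : ℤ) : ℕ :=
  ((involutions n).filter fun π => (descentNumber π : ℤ) = k).card

/-- The generating polynomial of the descent number over the involutions of `{1, …, n}`. -/
noncomputable def involutionPolynomial (n : ℕ) : Polynomial ℤ :=
  ∑ π ∈ involutions n, Polynomial.X ^ descentNumber π

/-! Descents become tractable once each involution π is replaced by its compatible sequences with
values in m = r + 1 letters. For fixed π there are C(n + r - des π, n) of them (`card_compatible`),
and the series of these numbers in r is t^(des π) / (1 - t)^(n+1). Hence, if c(n, m) counts pairs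
(π, a), then ∑ c(n, r+1) t^r = I_n(t) / (1 - t)^(n+1).

A pair is encoded by the multiset of columns (a i, a (π i)). As π is an involution, this is a
symmetric m × m array of naturals with sum n, and stable sorting recovers the pair
(`card_compatiblePair_eq_card_symmetricArray`).

Symmetric arrays have generating function P = (1 - x)^(-m) (1 - x²)^(-m(m-1)/2), so (1 - x²) P' = (m
+ m² x) P, which is a three-term recurrence for c(n, m) in n (`card_compatiblePair_recurrence`).
Multiplication by m = r + 1 acts on series in t as F ↦ (tF)'. Clearing powers of 1 - t gives the
differential recurrence for I_n(t), and its coefficients give the numerical one. -/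

/-- `a` is weakly increasing, and strictly so across every inversion of `π`. -/
def IsCompatible {n m : ℕ} (π : Equiv.Perm (Fin n)) (a : Fin n → Fin m) : Prop :=
  Monotone a ∧ ∀ i j, i < j → a i = a j → π i < π j

/-- The number of descents of `π` at positions before `i`. -/
def descentsBefore {n : ℕ} (π : Equiv.Perm (Fin n)) (i : Fin n) : ℕ :=
  (Finset.univ.filter fun j : Fin n =>
    j < i ∧ ∃ h : (j : ℕ) + 1 < n, π ⟨(j : ℕ) + 1, h⟩ < π j).card

/-! ### Descents and compatible sequences of a fixed permutation -/

section Descents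

variable {n : ℕ} (π : Equiv.Perm (Fin n))

theorem descentsBefore_mono : Monotone (descentsBefore π) := by
  intro i j hij
  apply Finset.card_le_card
  intro l
  simp only [Finset.mem_filter, Finset.mem_univ, true_and]
  exact fun h => ⟨h.1.trans_le hij, h.2⟩

theorem descentsBefore_le_add (i j : Fin n) :
    descentsBefore π j ≤ descentsBefore π i + ((j : ℕ) - i) := by
  rw [← Fin.card_Ico]
  refine le_trans (Finset.card_le_card ?_) (Finset.card_union_le _ _)
  intro l
  simp only [Finset.mem_filter, Finset.mem_univ, true_and, Finset.mem_union, Finset.mem_Ico]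
  intro h
  rcases lt_or_ge l i with hl | hl
  · exact Or.inl ⟨hl, h.2⟩
  · exact Or.inr ⟨hl, h.1⟩

theorem descentsBefore_le_val (i : Fin n) : descentsBefore π i ≤ i := by
  rw [← Fin.card_Iio i]
  apply Finset.card_le_card
  intro l
  simp only [Finset.mem_filter, Finset.mem_univ, true_and, Finset.mem_Iio]
  exact fun h => h.1

theorem descentsBefore_le_descentNumber (i : Fin n) : descentsBefore π i ≤ descentNumber π := by
  apply Finset.card_le_card
  intro l
  simp only [Finset.mem_filter, Finset.mem_univ, true_and]
  exact fun h => h.2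

theorem descentNumber_le_add (i : Fin n) :
    descentNumber π ≤ descentsBefore π i + (n - 1 - i) := by
  have hn : n - 1 < n := by have := i.2; omega
  have h : n - 1 - i = (Finset.Ico i ⟨n - 1, hn⟩).card := by rw [Fin.card_Ico]
  rw [h]
  refine le_trans (Finset.card_le_card ?_) (Finset.card_union_le _ _)
  intro l
  simp only [Finset.mem_filter, Finset.mem_univ, true_and, Finset.mem_union, Finset.mem_Ico]
  intro h
  rcases lt_or_ge l i with hl | hl
  · exact Or.inl ⟨hl, h⟩
  · refine Or.inr ⟨hl, ?_⟩
    obtain ⟨h, -⟩ := h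
    rw [Fin.lt_def]
    simp only
    omega

theorem descentNumber_le : descentNumber π ≤ n := by
  exact (Finset.card_filter_le _ _).trans_eq (Finset.card_fin n)

theorem descentsBefore_eq_of_forall {i j : Fin n} (hij : i ≤ j)
    (h : ∀ l : Fin n, i ≤ l → l < j → ∀ hl : (l : ℕ) + 1 < n, π l < π ⟨(l : ℕ) + 1, hl⟩) :
    descentsBefore π j = descentsBefore π i := by
  refine le_antisymm (Finset.card_le_card ?_) (descentsBefore_mono π hij)
  intro l
  simp only [Finset.mem_filter, Finset.mem_univ, true_and]
  rintro ⟨hlj, hl, hd⟩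
  refine ⟨?_, hl, hd⟩
  by_contra hc
  exact lt_asymm hd (h l (not_lt.1 hc) hlj hl)

/-- No descent can occur from `i` up to `j`, so `π` increases at each step between them. -/
theorem lt_of_descentsBefore_le {i j : Fin n} (hij : i < j)
    (h : descentsBefore π j ≤ descentsBefore π i) : π i < π j := by
  obtain ⟨k, hk⟩ : ∃ k, (j : ℕ) = i + k + 1 := ⟨j - i - 1, by have := Fin.lt_def.1 hij; omega⟩
  have step : ∀ l : Fin n, i ≤ l → l < j → ∀ hl : (l : ℕ) + 1 < n,
      π l < π ⟨(l : ℕ) + 1, hl⟩ := by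
    intro l hil hlj hl
    by_contra hc
    have hd : π ⟨(l : ℕ) + 1, hl⟩ < π l := by
      refine lt_of_le_of_ne (not_lt.1 hc) fun he => ?_
      have := congrArg Fin.val (π.injective he)
      simp at this
    refine absurd h (not_le.2 (Finset.card_lt_card ?_))
    refine ⟨?_, fun hs => ?_⟩
    · intro x
      simp only [Finset.mem_filter, Finset.mem_univ, true_and]
      exact fun hx => ⟨hx.1.trans hij, hx.2⟩
    · have := hs (x := l) (by simpa using ⟨hlj, hl, hd⟩)
      simp only [Finset.mem_filter, Finset.mem_univ, true_and] at this
      exact absurd this.1 (not_lt.2 hil)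
  have main : ∀ k : ℕ, ∀ hk : (i : ℕ) + k + 1 < n, (i : ℕ) + k + 1 ≤ j →
      π i < π ⟨i + k + 1, hk⟩ := by
    intro k
    induction k with
    | zero => exact fun hk hj => step i le_rfl hij hk
    | succ k ih =>
      intro hk hj
      exact (ih (by omega) (by omega)).trans
        (step ⟨i + k + 1, by omega⟩ (by rw [Fin.le_def]; simp only; omega)
          (by rw [Fin.lt_def]; simp only; omega) hk)
  have hj : j = ⟨i + k + 1, hk ▸ j.2⟩ := Fin.ext hk
  rw [hj]
  exact main k _ hk.ge

end Descents

theorem StrictMono.add_sub_le_fin {n : ℕ} {b : Fin n → ℕ} (hb : StrictMono b) {i j : Fin n}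
    (hij : i ≤ j) : b i + ((j : ℕ) - i) ≤ b j := by
  obtain ⟨k, hk⟩ : ∃ k, (j : ℕ) = i + k := ⟨j - i, by have := Fin.le_def.1 hij; omega⟩
  have main : ∀ k : ℕ, ∀ hk : (i : ℕ) + k < n, b i + k ≤ b ⟨i + k, hk⟩ := by
    intro k
    induction k with
    | zero => exact fun hk => le_rfl
    | succ k ih =>
      intro hk
      have h1 := ih (by omega)
      have h2 : b ⟨i + k, by omega⟩ < b ⟨i + (k + 1), hk⟩ :=
        hb (by rw [Fin.lt_def]; simp only; omega)
      omega
  have hj : j = ⟨i + k, hk ▸ j.2⟩ := Fin.ext hk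
  have := main k (hk ▸ j.2)
  rw [← hj] at this
  omega

/-- Adding the number of non-descents before each position turns compatible sequences into strictly
increasing ones. -/
def compatibleEquivOrderEmbedding {n : ℕ} (r : ℕ) (π : Equiv.Perm (Fin n)) :
    {a : Fin n → Fin (r + 1) // IsCompatible π a} ≃ (Fin n ↪o Fin (n + r - descentNumber π)) where
  toFun a := OrderEmbedding.ofStrictMono
    (fun i => ⟨a.1 i + (i - descentsBefore π i), by
      -- At most n - 1 - des π non-descents precede `i`, and `a i ≤ r`, so the sum stays below n + r
      -- - des π.
      have h1 := descentNumber_le_add π i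
      have h2 := descentsBefore_le_val π i
      have h3 := (a.1 i).2
      have h4 := i.2
      omega⟩)
    (by
      intro i j hij
      rw [Fin.lt_def]
      simp only
      have h1 := descentsBefore_le_val π i
      have h2 := descentsBefore_le_val π j
      have h3 := Fin.lt_def.1 hij
      rcases (a.2.1 hij.le).lt_or_eq with h | h
      · have := descentsBefore_le_add π i j
        have := Fin.lt_def.1 h
        omega
      -- Here `a` is constant from `i` to `j`, so compatibility excludes descents there and the
      -- added term grows by exactly j - i.
      · have : descentsBefore π j = descentsBefore π i := by
          refine descentsBefore_eq_of_forall π hij.le fun l hil hlj hl => ?_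
          have hlt : l < ⟨(l : ℕ) + 1, hl⟩ := by rw [Fin.lt_def]; simp
          refine a.2.2 _ _ hlt (le_antisymm (a.2.1 hlt.le) ?_)
          calc a.1 ⟨(l : ℕ) + 1, hl⟩ ≤ a.1 j :=
                a.2.1 (by rw [Fin.le_def]; exact Fin.lt_def.1 hlj)
            _ = a.1 i := h.symm
            _ ≤ a.1 l := a.2.1 hil
        have := congrArg Fin.val h
        omega)
  invFun b := ⟨fun i => ⟨b i - (i - descentsBefore π i), by
      have hb : StrictMono fun i => (b i : ℕ) := fun _ _ h => b.strictMono h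
      have h4 := i.2
      have h1 := hb.add_sub_le_fin (i := i) (j := ⟨n - 1, by omega⟩)
        (by rw [Fin.le_def]; simp only; omega)
      have h2 := (b ⟨n - 1, by omega⟩).2
      have h3 := descentsBefore_le_val π i
      have h5 := descentsBefore_le_descentNumber π i
      simp only at h1
      omega⟩, by
    have hb : StrictMono fun i => (b i : ℕ) := fun _ _ h => b.strictMono h
    have key : ∀ i j : Fin n, i ≤ j → (b i : ℕ) + (j - i) ≤ b j ∧
        descentsBefore π i ≤ descentsBefore π j ∧ descentsBefore π i ≤ i ∧
        descentsBefore π j ≤ j ∧ i ≤ (b i : ℕ) := by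
      refine fun i j hij => ⟨hb.add_sub_le_fin hij, descentsBefore_mono π hij,
        descentsBefore_le_val π i, descentsBefore_le_val π j, ?_⟩
      have := hb.add_sub_le_fin (i := ⟨0, i.pos⟩) (j := i) (by rw [Fin.le_def]; simp)
      simp only at this
      omega
    refine ⟨fun i j hij => ?_, fun i j hij h => lt_of_descentsBefore_le π hij ?_⟩
    · have := key i j hij
      have := Fin.le_def.1 hij
      rw [Fin.le_def]
      simp only
      omega
    · have := key i j hij.le
      have := Fin.lt_def.1 hij
      have := congrArg Fin.val h
      simp only at this
      omega⟩
  left_inv a := by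
    ext i
    exact Nat.add_sub_cancel _ _
  right_inv b := by
    ext i
    have hb : StrictMono fun i => (b i : ℕ) := fun _ _ h => b.strictMono h
    have := hb.add_sub_le_fin (i := ⟨0, i.pos⟩) (j := i) (by rw [Fin.le_def]; simp)
    simp only at this
    exact Nat.sub_add_cancel (by omega)

theorem card_compatible {n : ℕ} (r : ℕ) (π : Equiv.Perm (Fin n)) :
    Nat.card {a : Fin n → Fin (r + 1) // IsCompatible π a} =
      (n + r - descentNumber π).choose n := by
  rw [Nat.card_congr ((compatibleEquivOrderEmbedding r π).trans Set.powersetCard.ofFinEmbEquiv),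
    Set.powersetCard.card, Nat.card_fin]

/-! ### Words and the multisets of their letters -/

section Sorting

variable {α : Type*}

theorem exists_perm_comp_eq_of_card_fiber {ι : Type*} [Fintype ι] [DecidableEq α] {f g : ι → α}
    (h : ∀ x, (Finset.univ.filter fun i => f i = x).card =
      (Finset.univ.filter fun i => g i = x).card) : ∃ σ : Equiv.Perm ι, g ∘ σ = f := by
  have e : ∀ x, Nonempty ({i // f i = x} ≃ {i // g i = x}) := fun x =>
    Fintype.card_eq.1 (by rw [Fintype.card_subtype, Fintype.card_subtype, h x])
  exact ⟨Equiv.ofFiberEquiv fun x => (e x).some, funext fun i => Equiv.ofFiberEquiv_map _ i⟩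

theorem exists_fun_card_fiber [Fintype α] [DecidableEq α] {n : ℕ} (A : α → ℕ)
    (hA : ∑ x, A x = n) :
    ∃ p : Fin n → α, ∀ x, (Finset.univ.filter fun i => p i = x).card = A x := by
  have e : Nonempty (Fin n ≃ Σ x, Fin (A x)) := Fintype.card_eq.1 (by simp [hA])
  obtain ⟨e⟩ := e
  refine ⟨fun i => (e i).1, fun x => ?_⟩
  rw [← Fintype.card_subtype]
  have e' : {i // (e i).1 = x} ≃ Fin (A x) :=
    (e.subtypeEquiv (q := fun y => y.1 = x) fun i => Iff.rfl).trans
      (Equiv.sigmaSubtype x)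
  simpa using Fintype.card_congr e'

end Sorting

/-! ### Compatible pairs as symmetric arrays -/

section SymmetricArrays

variable {n m : ℕ}

/-- The pairs of an involution of `Fin n` and a compatible sequence with values in `Fin m`. -/
abbrev CompatiblePair (n m : ℕ) : Type :=
  {x : Equiv.Perm (Fin n) × (Fin n → Fin m) // (∀ i, x.1 (x.1 i) = i) ∧ IsCompatible x.1 x.2}

/-- The symmetric `m × m` arrays of natural numbers with sum `n`. -/
abbrev SymmetricArray (n m : ℕ) : Type :=
  {A : Fin m × Fin m → ℕ // (∀ x, A x.swap = A x) ∧ ∑ x, A x = n}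

/-- The two-line array of `a` and `a ∘ π`, with columns ordered lexicographically. -/
def pairWord (π : Equiv.Perm (Fin n)) (a : Fin n → Fin m) (i : Fin n) : Fin m ×ₗ Fin m :=
  toLex (a i, a (π i))

/-- Exchange of the components in the lexicographic product. -/
def lexSwap (x : Fin m ×ₗ Fin m) : Fin m ×ₗ Fin m :=
  toLex (ofLex x).swap

theorem lexSwap_lexSwap (x : Fin m ×ₗ Fin m) : lexSwap (lexSwap x) = x := rfl

theorem pairWord_monotone {π : Equiv.Perm (Fin n)} {a : Fin n → Fin m} (h : IsCompatible π a) :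
    Monotone (pairWord π a) := by
  intro i j hij
  rcases hij.eq_or_lt with rfl | hij
  · exact le_rfl
  rw [pairWord, pairWord, Prod.Lex.toLex_le_toLex]
  rcases (h.1 hij.le).lt_or_eq with h' | h'
  · exact Or.inl h'
  · exact Or.inr ⟨h', h.1 (h.2 i j hij h').le⟩

/-- Swapping the entries of every column permutes the columns by `π`, so `π` sorts the swapped word.
Compatibility orders ties by position, which characterises the stable sort. Hence the word
determines `π`. -/
theorem eq_sort_of_isCompatible {π : Equiv.Perm (Fin n)} {a : Fin n → Fin m}
    (hπ : ∀ i, π (π i) = i) (h : IsCompatible π a) :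
    π = Tuple.sort (lexSwap ∘ pairWord π a) := by
  have hs : ∀ i, lexSwap (pairWord π a (π i)) = pairWord π a i := by
    intro i
    simp [pairWord, lexSwap, hπ]
  rw [Tuple.eq_sort_iff]
  constructor
  · intro i j hij
    simp only [Function.comp_apply, hs]
    exact pairWord_monotone h hij
  · intro i j hij hp
    simp only [Function.comp_apply, hs] at hp
    exact h.2 i j hij (congrArg (fun x => (ofLex x).1) hp)

/-- The array counting the columns of the two-line array. -/
def columnCount (π : Equiv.Perm (Fin n)) (a : Fin n → Fin m) (x : Fin m × Fin m) : ℕ :=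
  (Finset.univ.filter fun i => pairWord π a i = toLex x).card

theorem columnCount_swap {π : Equiv.Perm (Fin n)} (hπ : ∀ i, π (π i) = i) (a : Fin n → Fin m)
    (x : Fin m × Fin m) : columnCount π a x.swap = columnCount π a x := by
  refine Finset.card_bij' (fun i _ => π i) (fun i _ => π i) ?_ ?_ ?_ ?_ <;>
    simp [pairWord, hπ, Prod.ext_iff] <;> tauto

theorem sum_columnCount (π : Equiv.Perm (Fin n)) (a : Fin n → Fin m) :
    ∑ x, columnCount π a x = n := by
  have := Finset.card_eq_sum_card_fiberwise (s := (Finset.univ : Finset (Fin n)))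
    (t := (Finset.univ : Finset (Fin m × Fin m))) (f := fun i => (a i, a (π i))) (by simp)
  rw [Finset.card_fin] at this
  exact this.symm

theorem isCompatible_ext {π π' : Equiv.Perm (Fin n)} {a a' : Fin n → Fin m}
    (hπ : ∀ i, π (π i) = i) (hπ' : ∀ i, π' (π' i) = i) (h : IsCompatible π a)
    (h' : IsCompatible π' a') (hA : columnCount π a = columnCount π' a') : π = π' ∧ a = a' := by
  obtain ⟨σ, hσ⟩ := exists_perm_comp_eq_of_card_fiber (f := pairWord π a) (g := pairWord π' a')
    fun x => congrFun hA (ofLex x)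
  have hp : pairWord π a = pairWord π' a' := by
    rw [← hσ]
    exact Tuple.unique_monotone (τ := 1) (by rw [hσ]; exact pairWord_monotone h)
      (pairWord_monotone h')
  constructor
  · rw [eq_sort_of_isCompatible hπ h, hp, ← eq_sort_of_isCompatible hπ' h']
  · funext i
    exact congrArg (fun x => (ofLex x).1) (congrFun hp i)

/-- List the cells of `A` with multiplicity in lexicographic order as `p`, and take for `π` the
stable sort of the swapped word. Symmetry of `A` makes the sorted swapped word equal to `p` again.
-/
theorem exists_isCompatible_of_symm (A : Fin m × Fin m → ℕ) (hA : ∀ x, A x.swap = A x)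
    (hn : ∑ x, A x = n) :
    ∃ (π : Equiv.Perm (Fin n)) (a : Fin n → Fin m),
      (∀ i, π (π i) = i) ∧ IsCompatible π a ∧ columnCount π a = A := by
  obtain ⟨q, hq⟩ := exists_fun_card_fiber (α := Fin m ×ₗ Fin m) (n := n) (fun x => A (ofLex x)) hn
  obtain ⟨p, hp, hpm⟩ : ∃ p : Fin n → Fin m ×ₗ Fin m,
      (∀ x, (Finset.univ.filter fun i => p i = x).card = A (ofLex x)) ∧ Monotone p := by
    refine ⟨q ∘ Tuple.sort q, fun x => ?_, Tuple.monotone_sort q⟩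
    rw [← hq x]
    exact Finset.card_bij' (fun i _ => Tuple.sort q i) (fun i _ => (Tuple.sort q).symm i)
      (by simp) (by simp) (by simp) (by simp)
  obtain ⟨σ, hσ⟩ := exists_perm_comp_eq_of_card_fiber (f := p) (g := lexSwap ∘ p) fun x => by
    rw [hp x, ← hA]
    refine (hp (lexSwap x)).symm.trans ?_
    congr 1
    ext i
    simp only [Finset.mem_filter, Finset.mem_univ, true_and, Function.comp_apply]
    exact ⟨fun h => by rw [h, lexSwap_lexSwap], fun h => by rw [← h, lexSwap_lexSwap]⟩
  obtain ⟨π, hπ⟩ : ∃ π, π = Tuple.sort (lexSwap ∘ p) := ⟨_, rfl⟩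
  have hπp : (lexSwap ∘ p) ∘ π = p := by
    rw [hπ]
    refine (Tuple.unique_monotone (Tuple.monotone_sort _) (τ := σ) ?_).trans hσ
    rw [hσ]
    exact hpm
  have hswap : ∀ i, p (π i) = lexSwap (p i) := fun i => by
    
    exact (lexSwap_lexSwap _).symm.trans (congrArg lexSwap (congrFun hπp i))
  have htie : ∀ i j, i < j → p i = p j → π i < π j := by
    intro i j hij h
    refine (Tuple.eq_sort_iff.1 hπ).2 i j hij ?_
    exact (congrFun hπp i).trans (h.trans (congrFun hπp j).symm)
  have hinv : ∀ i, π (π i) = i := by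
    -- Applying `π` twice swaps a column twice, so distinct columns keep their order; equal columns
    -- keep theirs by stability. The only increasing permutation is the identity.
    have hmono : StrictMono (π * π) := by
      intro i j hij
      rw [Equiv.Perm.mul_apply, Equiv.Perm.mul_apply]
      rcases (hpm hij.le).lt_or_eq with h | h
      · by_contra hc
        have := hpm (not_lt.1 hc)
        rw [hswap, hswap, hswap, hswap, lexSwap_lexSwap, lexSwap_lexSwap] at this
        exact absurd h (not_lt.2 this)
      · exact htie _ _ (htie _ _ hij h) (by rw [hswap, hswap, h])
    have := (Equiv.Perm.monotone_iff _).1 hmono.monotone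
    exact fun i => by rw [← Equiv.Perm.mul_apply, this, Equiv.Perm.one_apply]
  have hword : pairWord π (fun i => (ofLex (p i)).1) = p := by
    funext i
    rw [pairWord, hswap]
    rfl
  refine ⟨π, fun i => (ofLex (p i)).1, hinv, ⟨fun i j hij => ?_, fun i j hij h => ?_⟩, ?_⟩
  · exact Prod.Lex.monotone_fst _ _ (hpm hij)
  · rcases (hpm hij.le).lt_or_eq with hlt | heq
    · have h2 : (ofLex (p i)).2 < (ofLex (p j)).2 := by
        rcases (Prod.Lex.lt_iff).1 hlt with h' | h'
        · exact absurd h h'.ne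
        · exact h'.2
      by_contra hc
      have := Prod.Lex.monotone_fst _ _ (hpm (not_lt.1 hc))
      rw [hswap, hswap] at this
      exact absurd h2 (not_lt.2 this)
    · exact htie i j hij heq
  · funext x
    rw [columnCount, hword]
    exact hp (toLex x)

theorem card_compatiblePair_eq_card_symmetricArray :
    Nat.card (CompatiblePair n m) = Nat.card (SymmetricArray n m) := by
  refine Nat.card_eq_of_bijective (fun x => ⟨columnCount x.1.1 x.1.2,
    columnCount_swap x.2.1 _, sum_columnCount _ _⟩) ⟨?_, ?_⟩
  · rintro ⟨⟨π, a⟩, hπ, h⟩ ⟨⟨π', a'⟩, hπ', h'⟩ hA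
    obtain ⟨h1, h2⟩ := isCompatible_ext hπ hπ' h h' (congrArg Subtype.val hA)
    simp only at h1 h2
    subst h1 h2
    rfl
  · rintro ⟨A, hA, hn⟩
    obtain ⟨π, a, hπ, h, hc⟩ := exists_isCompatible_of_symm A hA hn
    exact ⟨⟨(π, a), hπ, h⟩, Subtype.ext hc⟩

theorem card_compatiblePair (n r : ℕ) :
    Nat.card (CompatiblePair n (r + 1)) =
      ∑ π ∈ involutions n, (n + r - descentNumber π).choose n := by
  classical
  have e : CompatiblePair n (r + 1) ≃
      Σ π : {π // π ∈ involutions n}, {a : Fin n → Fin (r + 1) // IsCompatible π.1 a} :=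
    { toFun := fun x => ⟨⟨x.1.1, by simpa [involutions] using x.2.1⟩, x.1.2, x.2.2⟩
      invFun := fun y => ⟨(y.1.1, y.2.1), (Finset.mem_filter.1 y.1.2).2, y.2.2⟩
      left_inv := fun _ => rfl
      right_inv := fun _ => rfl }
  rw [Nat.card_congr e, Nat.card_sigma, ← Finset.sum_coe_sort (involutions n)]
  exact Finset.sum_congr rfl fun π _ => card_compatible r (π : Equiv.Perm (Fin n))

end SymmetricArrays

/-! ### Products of geometric series and their logarithmic derivatives -/

section Weighted

open PowerSeries

/-- The power series of the multiples of `w`. -/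
noncomputable def multiplesSeries (w : ℕ) : ℤ⟦X⟧ :=
  PowerSeries.mk fun k => if w ∣ k then 1 else 0

theorem coeff_prod_multiplesSeries {ι : Type*} [Fintype ι] [DecidableEq ι] (w : ι → ℕ)
    (hw : ∀ e, 0 < w e) (n : ℕ) :
    coeff n (∏ e, multiplesSeries (w e)) =
      (Nat.card {g : ι → ℕ // ∑ e, w e * g e = n} : ℤ) := by
  rw [PowerSeries.coeff_prod]
  have h1 : ∀ l : ι →₀ ℕ, ∏ e, coeff (l e) (multiplesSeries (w e)) =
      if ∀ e, w e ∣ l e then (1 : ℤ) else 0 := by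
    intro l
    simp only [multiplesSeries, coeff_mk]
    rw [Finset.prod_ite_zero]
    simp
  rw [Finset.sum_congr rfl fun l _ => h1 l, Finset.sum_boole, ← Fintype.card_coe,
    ← Nat.card_eq_fintype_card]
  refine congrArg Nat.cast (Nat.card_congr ?_)
  exact
    { toFun := fun l => ⟨fun e => l.1 e / w e, by
        obtain ⟨h, hd⟩ := Finset.mem_filter.1 l.2
        exact (Finset.sum_congr rfl fun e _ => Nat.mul_div_cancel' (hd e)).trans
          (Finset.mem_finsuppAntidiag.1 h).1⟩
      invFun := fun g => ⟨Finsupp.equivFunOnFinite.symm fun e => w e * g.1 e, by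
        refine Finset.mem_filter.2 ⟨Finset.mem_finsuppAntidiag.2 ⟨g.2, by simp⟩, fun e => ?_⟩
        exact dvd_mul_right _ _⟩
      left_inv := fun l => by
        ext e
        exact Nat.mul_div_cancel' ((Finset.mem_filter.1 l.2).2 e)
      right_inv := fun g => by
        ext e
        exact Nat.mul_div_cancel_left _ (hw e) }

theorem one_sub_mul_multiplesSeries {w : ℕ} (hw : 0 < w) :
    (1 - X ^ w) * multiplesSeries w = 1 := by
  ext k
  rw [sub_mul, one_mul, map_sub, coeff_X_pow_mul', coeff_one]
  simp only [multiplesSeries, coeff_mk]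
  rcases Nat.lt_or_ge k w with h | h
  · rw [if_neg h.not_ge, sub_zero]
    refine if_congr ⟨fun hd => Nat.eq_zero_of_dvd_of_lt hd h, fun h0 => h0 ▸ dvd_zero w⟩ rfl rfl
  · rw [if_pos h, if_neg (by omega : k ≠ 0), sub_eq_zero]
    exact if_congr (Nat.dvd_sub_iff_left h dvd_rfl).symm rfl rfl

theorem derivative_multiplesSeries_one :
    (1 - X ^ 2) * d⁄dX ℤ (multiplesSeries 1) = (1 + X) * multiplesSeries 1 := by
  have h := one_sub_mul_multiplesSeries one_pos
  have hd := congrArg (d⁄dX ℤ) h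
  rw [Derivation.leibniz] at hd
  simp only [smul_eq_mul, pow_one, map_sub, derivative_X, Derivation.map_one_eq_zero] at hd h
  linear_combination (1 + X) * hd

theorem derivative_multiplesSeries_two :
    (1 - X ^ 2) * d⁄dX ℤ (multiplesSeries 2) = 2 * X * multiplesSeries 2 := by
  have h := one_sub_mul_multiplesSeries two_pos
  have hd := congrArg (d⁄dX ℤ) h
  rw [Derivation.leibniz] at hd
  simp only [smul_eq_mul, map_sub, derivative_X, derivative_pow,
    Derivation.map_one_eq_zero] at hd h
  push_cast at hd
  linear_combination hd

/-- Logarithmic derivatives add, and 1 - X² is a common denominator for the weights 1 and 2. -/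
theorem derivative_prod_multiplesSeries {ι : Type*} (s : Finset ι) (w : ι → ℕ)
    (hw : ∀ e, w e = 1 ∨ w e = 2) :
    (1 - X ^ 2) * d⁄dX ℤ (∏ e ∈ s, multiplesSeries (w e)) =
      (∑ e ∈ s, if w e = 1 then 1 + X else 2 * X) * ∏ e ∈ s, multiplesSeries (w e) := by
  classical
  induction s using Finset.induction_on with
  | empty => simp
  | insert e s he ih =>
    rw [Finset.prod_insert he, Finset.sum_insert he, Derivation.leibniz]
    simp only [smul_eq_mul]
    have h : (1 - X ^ 2) * d⁄dX ℤ (multiplesSeries (w e)) =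
        (if w e = 1 then 1 + X else 2 * X) * multiplesSeries (w e) := by
      rcases hw e with h | h
      · simp [h, derivative_multiplesSeries_one]
      · simp [h, derivative_multiplesSeries_two]
    linear_combination multiplesSeries (w e) * ih + (∏ e ∈ s, multiplesSeries (w e)) * h

end Weighted

/-! ### Enumeration of symmetric arrays -/

section Sym2Arrays

/-- The number of ordered pairs representing an unordered pair. -/
def Sym2.multiplicity {α : Type*} [DecidableEq α] (e : Sym2 α) : ℕ :=
  if e.IsDiag then 1 else 2

theorem Sym2.sum_mk_eq {α : Type*} [Fintype α] [DecidableEq α] {R : Type*}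
    [Semiring R] (g : Sym2 α → R) :
    ∑ x : α × α, g s(x.1, x.2) = ∑ e, (e.multiplicity : R) * g e := by
  rw [← Finset.sum_fiberwise_of_maps_to (s := Finset.univ) (t := (Finset.univ : Finset (Sym2 α)))
    (g := fun x : α × α => s(x.1, x.2)) (by simp)]
  refine Finset.sum_congr rfl fun e _ => ?_
  rw [Finset.sum_congr rfl (g := fun _ => g e)
    (by intro x hx; rw [(Finset.mem_filter.1 hx).2]), Finset.sum_const, nsmul_eq_mul]
  congr 2
  induction e using Sym2.inductionOn with
  | hf a b =>
    have : (Finset.univ.filter fun x : α × α => s(x.1, x.2) = s(a, b)) = {(a, b), (b, a)} := by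
      ext ⟨x, y⟩
      simp
    rw [this, Sym2.multiplicity]
    by_cases h : a = b
    · simp [h]
    · rw [Finset.card_pair (by simp [h])]
      simp [h]

/-- A symmetric array is a function on unordered pairs. -/
def symmetricArrayEquiv (n m : ℕ) : SymmetricArray n m ≃
    {g : Sym2 (Fin m) → ℕ // ∑ e, e.multiplicity * g e = n} where
  toFun A := ⟨Sym2.lift ⟨fun i j => A.1 (i, j), fun i j => A.2.1 (j, i)⟩, by
    exact (Sym2.sum_mk_eq _).symm.trans A.2.2⟩
  invFun g := ⟨fun x => g.1 s(x.1, x.2), fun x => congrArg g.1 Sym2.eq_swap, by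
    exact (Sym2.sum_mk_eq g.1).trans g.2⟩
  left_inv A := rfl
  right_inv g := by
    ext e
    induction e using Sym2.inductionOn with
    | hf a b => rfl

/-- Split over ordered pairs: each of the m² pairs contributes X, and each of the m diagonal ones a
further 1. -/
theorem sum_sym2_logDerivative (m : ℕ) :
    ∑ e : Sym2 (Fin m), (if e.multiplicity = 1 then 1 + PowerSeries.X else
      2 * PowerSeries.X : PowerSeries ℤ) =
      (m : PowerSeries ℤ) + (m : PowerSeries ℤ) ^ 2 * PowerSeries.X := by
  have h := Sym2.sum_mk_eq fun e : Sym2 (Fin m) =>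
    (if e.IsDiag then 1 + PowerSeries.X else PowerSeries.X : PowerSeries ℤ)
  have h1 : ∀ e : Sym2 (Fin m), (if e.multiplicity = 1 then 1 + PowerSeries.X else
      2 * PowerSeries.X : PowerSeries ℤ) = (e.multiplicity : PowerSeries ℤ) *
      (if e.IsDiag then 1 + PowerSeries.X else PowerSeries.X : PowerSeries ℤ) := by
    intro e
    by_cases he : e.IsDiag <;> simp [Sym2.multiplicity, he]
  have h2 : ∀ x : Fin m × Fin m, (if s(x.1, x.2).IsDiag then 1 + PowerSeries.X else
      PowerSeries.X : PowerSeries ℤ) = (if x.1 = x.2 then 1 else 0) + PowerSeries.X := by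
    intro x
    by_cases he : x.1 = x.2 <;> simp [he]
  rw [Finset.sum_congr rfl fun e _ => h1 e, ← h, Finset.sum_congr rfl fun x _ => h2 x,
    Finset.sum_add_distrib, Fintype.sum_prod_type]
  simp [pow_two]

open PowerSeries in
theorem card_compatiblePair_recurrence (n m : ℕ) :
    ((n : ℤ) + 2) * Nat.card (CompatiblePair (n + 2) m) =
      m * Nat.card (CompatiblePair (n + 1) m) + ((m : ℤ) ^ 2 + n) * Nat.card (CompatiblePair n m) := by
  set P : ℤ⟦X⟧ := ∏ e : Sym2 (Fin m), multiplesSeries e.multiplicity with hP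
  have hw : ∀ e : Sym2 (Fin m), e.multiplicity = 1 ∨ e.multiplicity = 2 := fun e => by
    unfold Sym2.multiplicity; split_ifs <;> simp
  have hc : ∀ k, (Nat.card (CompatiblePair k m) : ℤ) = coeff k P := fun k => by
    rw [card_compatiblePair_eq_card_symmetricArray, Nat.card_congr (symmetricArrayEquiv k m), hP,
      coeff_prod_multiplesSeries]
    intro e
    rcases hw e with h | h <;> omega
  have hd := derivative_prod_multiplesSeries Finset.univ _ hw
  rw [← hP, sum_sym2_logDerivative] at hd
  -- The recurrence is the coefficient of X^(n+1) in (1 - X²) P' = (m + m² X) P.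
  have h := congrArg (coeff (n + 1)) hd
  have h2 : coeff (n + 1) (X ^ 2 * d⁄dX ℤ P) = n * coeff n P := by
    cases n with
    | zero => rw [coeff_X_pow_mul']; simp
    | succ k =>
      rw [show k + 1 + 1 = k + 2 from rfl, coeff_X_pow_mul, coeff_derivative]
      push_cast
      ring
  have h3 : ((m : ℤ⟦X⟧) + (m : ℤ⟦X⟧) ^ 2 * X) * P = C (m : ℤ) * P + X * (C ((m : ℤ) ^ 2) * P) := by
    simp only [map_pow, map_natCast]
    ring
  rw [h3, sub_mul, one_mul, map_sub, h2, coeff_derivative, map_add, coeff_C_mul,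
    coeff_succ_X_mul, coeff_C_mul] at h
  rw [hc, hc, hc]
  push_cast at h
  linear_combination h

end Sym2Arrays

/-! ### From array counts to the descent polynomial -/

section GeneratingFunction

open PowerSeries

/-- The binomial vanishes for r < d, so the series is X^d times that of 1 / (1 - X)^(n+1). -/
theorem mk_choose_mul_one_sub_pow {n d : ℕ} (hd : d ≤ n) :
    (1 - X) ^ (n + 1) * (PowerSeries.mk fun r => ((n + r - d).choose n : ℤ)) = X ^ d := by
  have h : (PowerSeries.mk fun r => ((n + r - d).choose n : ℤ)) =
      X ^ d * PowerSeries.mk fun r => ((n + r).choose n : ℤ) := by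
    ext r
    rw [coeff_X_pow_mul', coeff_mk]
    split_ifs with hr
    · rw [coeff_mk, Nat.add_sub_assoc hr]
    · rw [Nat.choose_eq_zero_of_lt (by omega), Nat.cast_zero]
  have h1 := mk_add_choose_mul_one_sub_pow_eq_one ℤ n
  rw [h]
  linear_combination X ^ d * h1

/-- The generating series of the number of compatible pairs with values in `Fin (r + 1)`. -/
noncomputable def compatibleSeries (n : ℕ) : ℤ⟦X⟧ :=
  PowerSeries.mk fun r => (Nat.card (CompatiblePair n (r + 1)) : ℤ)

theorem one_sub_pow_mul_compatibleSeries (n : ℕ) :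
    (1 - X) ^ (n + 1) * compatibleSeries n = (involutionPolynomial n : ℤ⟦X⟧) := by
  have h : compatibleSeries n = ∑ π ∈ involutions n,
      PowerSeries.mk fun r => ((n + r - descentNumber π).choose n : ℤ) := by
    ext r
    simp [compatibleSeries, card_compatiblePair]
  rw [h, Finset.mul_sum, involutionPolynomial, ← Polynomial.coeToPowerSeries.ringHom_apply, map_sum]
  refine Finset.sum_congr rfl fun π _ => ?_
  rw [mk_choose_mul_one_sub_pow (descentNumber_le π)]
  simp

/-- The array recurrence at m = r + 1: the factors m and m² become one and two applications of F ↦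
(XF)'. -/
theorem compatibleSeries_recurrence (n : ℕ) :
    ((n : ℤ⟦X⟧) + 2) * compatibleSeries (n + 2) =
      d⁄dX ℤ (X * compatibleSeries (n + 1)) +
      d⁄dX ℤ (X * d⁄dX ℤ (X * compatibleSeries n)) + n * compatibleSeries n := by
  ext r
  have h := card_compatiblePair_recurrence n (r + 1)
  have hc : ((n : ℤ⟦X⟧) + 2) * compatibleSeries (n + 2) =
      C ((n : ℤ) + 2) * compatibleSeries (n + 2) := by simp
  have hc' : (n : ℤ⟦X⟧) * compatibleSeries n = C (n : ℤ) * compatibleSeries n := by simp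
  rw [hc, hc', coeff_C_mul, map_add, map_add, coeff_C_mul, coeff_derivative, coeff_succ_X_mul,
    coeff_derivative, coeff_succ_X_mul, coeff_derivative, coeff_succ_X_mul]
  simp only [compatibleSeries, coeff_mk]
  push_cast at h
  linear_combination h

theorem one_sub_mul_derivative_of_eq {F G : ℤ⟦X⟧} {k : ℕ} (h : (1 - X) ^ k * F = G) :
    (1 - X) ^ (k + 1) * d⁄dX ℤ F = (1 - X) * d⁄dX ℤ G + (k : ℤ⟦X⟧) * G := by
  have hd := congrArg (d⁄dX ℤ) h
  rw [Derivation.leibniz, derivative_pow] at hd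
  simp only [smul_eq_mul, map_sub, derivative_X, Derivation.map_one_eq_zero] at hd
  rw [← hd, ← h]
  cases k with
  | zero => simp
  | succ k => simp only [Nat.add_sub_cancel]; ring

end GeneratingFunction

open Polynomial in
theorem involutionPolynomial_recurrence (n : ℕ) :
    ((n : ℤ[X]) + 2) * involutionPolynomial (n + 2) =
      (X - X ^ 2) * derivative (involutionPolynomial (n + 1))
      + (1 + ((n : ℤ[X]) + 1) * X) * involutionPolynomial (n + 1)
      + X ^ 2 * (1 - X) ^ 2 * derivative (derivative (involutionPolynomial n))
      + X * (1 - X) * (3 + (2 * (n : ℤ[X]) - 1) * X) * derivative (involutionPolynomial n)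
      + ((n : ℤ[X]) + 1) * (1 + X + (n : ℤ[X]) * X ^ 2) * involutionPolynomial n := by
  have h2 := one_sub_pow_mul_compatibleSeries (n + 2)
  have h1 := one_sub_pow_mul_compatibleSeries (n + 1)
  have h0 := one_sub_pow_mul_compatibleSeries n
  have d1 := one_sub_mul_derivative_of_eq h1
  have d0 := one_sub_mul_derivative_of_eq h0
  have dd0 := one_sub_mul_derivative_of_eq d0
  have hr := compatibleSeries_recurrence n
  simp only [Derivation.leibniz, map_add, smul_eq_mul, PowerSeries.derivative_X, mul_one] at hr
  simp only [Derivation.leibniz, map_add, map_sub, smul_eq_mul, PowerSeries.derivative_X,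
    Derivation.map_one_eq_zero, Derivation.map_natCast, PowerSeries.derivative_coe] at d0 d1 dd0
  have hnat : ((n : ℤ[X]) : PowerSeries ℤ) = n :=
    map_natCast Polynomial.coeToPowerSeries.ringHom n
  have hofNat2 : ((2 : ℤ[X]) : PowerSeries ℤ) = 2 :=
    map_ofNat Polynomial.coeToPowerSeries.ringHom 2
  have hofNat3 : ((3 : ℤ[X]) : PowerSeries ℤ) = 3 :=
    map_ofNat Polynomial.coeToPowerSeries.ringHom 3
  apply Polynomial.coe_injective
  simp only [Polynomial.coe_add, Polynomial.coe_mul, Polynomial.coe_sub, Polynomial.coe_pow,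
    Polynomial.coe_X, Polynomial.coe_one, hnat, hofNat2, hofNat3]
  push_cast at h0 h1 h2 hr d0 d1 dd0 ⊢
  -- Multiplying by (1 - X)^(n+3) clears all denominators; the factors 1 + n, 3X and X² come from
  -- (X(XF)')' + nF = (1 + n)F + 3XF' + X²F''.
  linear_combination (1 - PowerSeries.X) ^ (n + 3) * hr - ((n : PowerSeries ℤ) + 2) * h2
    + (1 - PowerSeries.X) * h1 + PowerSeries.X * d1
    + (1 + (n : PowerSeries ℤ)) * (1 - PowerSeries.X) ^ 2 * h0
    + 3 * PowerSeries.X * (1 - PowerSeries.X) * d0 + PowerSeries.X ^ 2 * dd0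

/-! ### Extraction of coefficients -/

section Coefficients

open Polynomial

/-- The coefficient of a polynomial at an integer index, zero at negative ones. -/
noncomputable def intCoeff (k : ℤ) : ℤ[X] →ₗ[ℤ] ℤ :=
  if k < 0 then 0 else lcoeff ℤ k.toNat

theorem intCoeff_of_neg {k : ℤ} (hk : k < 0) (p : ℤ[X]) : intCoeff k p = 0 := by
  simp [intCoeff, hk]

theorem intCoeff_natCast (k : ℕ) (p : ℤ[X]) : intCoeff k p = p.coeff k := by
  rw [intCoeff, if_neg (by omega), Int.toNat_natCast, lcoeff_apply]

theorem intCoeff_intCast_mul (k a : ℤ) (p : ℤ[X]) :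
    intCoeff k ((a : ℤ[X]) * p) = a * intCoeff k p := by
  rw [← zsmul_eq_mul, map_zsmul, smul_eq_mul]

theorem intCoeff_X_mul (k : ℤ) (p : ℤ[X]) : intCoeff k (X * p) = intCoeff (k - 1) p := by
  rcases lt_or_ge k 0 with hk | hk
  · rw [intCoeff_of_neg hk, intCoeff_of_neg (by omega)]
  lift k to ℕ using hk
  cases k with
  | zero => rw [intCoeff_natCast, intCoeff_of_neg (by simp), coeff_X_mul_zero]
  | succ k =>
    rw [intCoeff_natCast, coeff_X_mul, Nat.cast_succ, add_sub_cancel_right, intCoeff_natCast]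

theorem intCoeff_X_mul_derivative (k : ℤ) (p : ℤ[X]) :
    intCoeff k (X * derivative p) = k * intCoeff k p := by
  rcases lt_or_ge k 0 with hk | hk
  · rw [intCoeff_of_neg hk, intCoeff_of_neg hk, mul_zero]
  lift k to ℕ using hk
  rw [intCoeff_natCast, intCoeff_natCast]
  cases k with
  | zero => simp
  | succ k =>
    rw [coeff_X_mul, coeff_derivative]
    push_cast
    ring

theorem involutionDescentCount_eq_intCoeff (n : ℕ) (k : ℤ) :
    (involutionDescentCount n k : ℤ) = intCoeff k (involutionPolynomial n) := by
  rcases lt_or_ge k 0 with hk | hk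
  · rw [intCoeff_of_neg hk, involutionDescentCount, Finset.filter_eq_empty_iff.2]
    · simp
    · intro π _
      omega
  lift k to ℕ using hk
  rw [intCoeff_natCast, involutionPolynomial, finsetSum_coeff, involutionDescentCount]
  simp [coeff_X_pow, eq_comm]

end Coefficients

open Polynomial in
theorem involutionDescentCount_recurrence (n : ℕ) (k : ℤ) :
    ((n : ℤ) + 2) * (involutionDescentCount (n + 2) k : ℤ) =
      (k + 1) * (involutionDescentCount (n + 1) k : ℤ)
      + ((n : ℤ) + 2 - k) * (involutionDescentCount (n + 1) (k - 1) : ℤ)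
      + ((k + 1) ^ 2 + (n : ℤ)) * (involutionDescentCount n k : ℤ)
      + (2 * k * ((n : ℤ) + 1 - k) - (n : ℤ) + 1) * (involutionDescentCount n (k - 1) : ℤ)
      + (((n : ℤ) + 2 - k) ^ 2 + (n : ℤ)) * (involutionDescentCount n (k - 2) : ℤ) := by
  have h := involutionPolynomial_recurrence n
  simp only [involutionDescentCount_eq_intCoeff]
  set P := involutionPolynomial (n + 2)
  set Q := involutionPolynomial (n + 1)
  set R := involutionPolynomial n
  set θQ := X * derivative Q with hθQ
  set θR := X * derivative R with hθR
  set θθR := X * derivative θR with hθθR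
  -- In terms of the Euler operator θ = X d/dX, which multiplies the k-th coefficient by k, every
  -- term can be read off coefficientwise.
  have hdd : X ^ 2 * derivative (derivative R) = θθR - θR := by
    rw [hθθR, hθR, derivative_mul, derivative_X]
    ring
  have h' : ((n + 2 : ℤ) : ℤ[X]) * P =
      θQ - X * θQ + Q + ((n + 1 : ℤ) : ℤ[X]) * (X * Q)
      + (θθR - ((2 : ℤ) : ℤ[X]) * (X * θθR) + X * (X * θθR))
      + ((2 : ℤ) : ℤ[X]) * θR + ((2 * n - 2 : ℤ) : ℤ[X]) * (X * θR)
      - ((2 * n : ℤ) : ℤ[X]) * (X * (X * θR))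
      + ((n + 1 : ℤ) : ℤ[X]) * (R + X * R + ((n : ℤ) : ℤ[X]) * (X * (X * R))) := by
    push_cast
    linear_combination h + (1 - X) ^ 2 * hdd - (1 - X) * hθQ
      - (1 - X) * (3 + (2 * (n : ℤ[X]) - 1) * X) * hθR
  have hk := congrArg (intCoeff k) h'
  have h1 : ∀ k, intCoeff k θQ = k * intCoeff k Q := fun k => intCoeff_X_mul_derivative k Q
  have h2 : ∀ k, intCoeff k θR = k * intCoeff k R := fun k => intCoeff_X_mul_derivative k R
  have h3 : ∀ k, intCoeff k θθR = k * intCoeff k θR := fun k => intCoeff_X_mul_derivative k θR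
  simp only [map_add, map_sub, intCoeff_intCast_mul, intCoeff_X_mul, h1, h2, h3] at hk
  rw [show k - 1 - 1 = k - 2 by ring] at hk
  linear_combination hk

open Polynomial in
theorem theorem2p2 (n : ℕ) (hn : 3 ≤ n) :
    (∀ k : ℤ, 0 ≤ k →
      (n : ℤ) * (involutionDescentCount n k : ℤ) =
        (k + 1) * (involutionDescentCount (n - 1) k : ℤ)
        + ((n : ℤ) - k) * (involutionDescentCount (n - 1) (k - 1) : ℤ)
        + ((k + 1) ^ 2 + (n : ℤ) - 2) * (involutionDescentCount (n - 2) k : ℤ)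
        + (2 * k * ((n : ℤ) - k - 1) - (n : ℤ) + 3)
            * (involutionDescentCount (n - 2) (k - 1) : ℤ)
        + (((n : ℤ) - k) ^ 2 + (n : ℤ) - 2)
            * (involutionDescentCount (n - 2) (k - 2) : ℤ)) ∧
    (n : ℤ[X]) * involutionPolynomial n =
      (X - X ^ 2) * derivative (involutionPolynomial (n - 1))
      + (1 + ((n : ℤ[X]) - 1) * X) * involutionPolynomial (n - 1)
      + X ^ 2 * (1 - X) ^ 2 * derivative (derivative (involutionPolynomial (n - 2)))
      + X * (1 - X) * (3 + (2 * (n : ℤ[X]) - 5) * X)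
          * derivative (involutionPolynomial (n - 2))
      + ((n : ℤ[X]) - 1) * (1 + X + ((n : ℤ[X]) - 2) * X ^ 2)
          * involutionPolynomial (n - 2) := by
  obtain ⟨m, rfl⟩ : ∃ m, n = m + 2 := ⟨n - 2, by omega⟩
  rw [show m + 2 - 1 = m + 1 from rfl, show m + 2 - 2 = m from rfl]
  push_cast
  refine ⟨fun k _ => ?_, ?_⟩
  · linear_combination involutionDescentCount_recurrence m k
  · linear_combination involutionPolynomial_recurrence m
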